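/- Let $k\ge 0$ be an integer and let $\mathcal A\subset\mathbb Z^k$ be a finite set with $0\notin\mathcal A$ and $\mathcal A=-\mathcal A$ that generates the group $\mathbb Z^k$. Let $\Gamma=\mathrm{Cay}(\mathbb Z^k,\mathcal A)$ be its Cayley graph: the vertices are the elements of $\mathbb Z^k$, and $x,y$ are adjacent iff $y-x\in\mathcal A$. For $x\in\mathbb Z^k$ let $\rho(x)$ be the length, and $\omega(x)$ the number, of shortest paths from $0$ to $x$ in $\Gamma$. For an integer $r\ge 0$ let $B_r$ be the subgraph of $\Gamma$ induced by $\{x:\rho(x)\le r\}$, and let $B_r+x$ be its translate by $x$. Let $\|\mathcal A\|$ be the largest absolute value of a coordinate of an element of $\mathcal A$ (and $0$ if $\mathcal A=\varnothing$). An element $x\in\mathcal A$ is called primary if $\rho(tx)=t$ and $\omega(tx)=1$ for every integer $t\ge0$; the other elements of $\mathcal A$ are called secondary. Then the following hold. (i) There is an integer $D\ge 0$ such that $\rho(Dx)\ne D$ or $\omega(Dx)\neq 1$ for every secondary $x\in\mathcal A$. (ii) There is an integer $R\ge0$ such that for every integer $r\ge R$ each automorphism of the graph $B_r$ is the restriction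 of a non-degenerate linear map $\mathbb R^k\to\mathbb R^k$ and has a unique extension to an automorphism of $\Gamma$ that fixes $0$. (iii) Let $D$ and $R$ be any integers with the properties in (i) and (ii), and let $r$ be an integer with $r\ge\max(R,\,2,\,D,\,2\|\mathcal A\|+1)$. Let $M\subseteq\mathbb Z^k$ be a non-empty set of vertices that induces a connected subgraph of $\Gamma$, and let $C$ be the subgraph of $\Gamma$ induced by $\bigcup_{x\in M}V(B_r+x)$. Let $\lambda$ be any (not necessarily induced) subgraph of $\Gamma$ and let $\varphi:C\to\lambda$ be a graph isomorphism. Then there is a unique non-degenerate affine map $T:\mathbb R^k\to\mathbb R^k$ such that $\varphi(x)=T(x)$ for all $x\in V(C)$. Furthermore, $T$ restricts to an automorphism of $\Gamma$. -/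

import Mathlib

namespace BallBundle

/-- The Cayley graph `Γ` of the group `ℤᵏ` with respect to the finite set `A`. -/
abbrev Gam {k : ℕ} (A : Finset (Fin k → ℤ)) : SimpleGraph (Fin k → ℤ) :=
  SimpleGraph.addCayley (A : Set (Fin k → ℤ))

/-- The inclusion of `ℤᵏ` in `ℝᵏ`. -/
def toReal {k : ℕ} (x : Fin k → ℤ) : Fin k → ℝ := fun i => (x i : ℝ)

/-- `ρ(x)`: the length of a shortest path from `0` to `x` in `Γ`
(meaningful when `A` generates `ℤᵏ`, so that `Γ` is connected). -/
noncomputable def rho {k : ℕ} (A : Finset (Fin k → ℤ)) (x : Fin k → ℤ) : ℕ :=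
  (Gam A).dist 0 x

/-- `ω(x)`: the number of shortest paths from `0` to `x` in `Γ`. -/
noncomputable def omega {k : ℕ} (A : Finset (Fin k → ℤ)) (x : Fin k → ℤ) : ℕ :=
  Set.ncard {p : (Gam A).Walk 0 x | p.IsPath ∧ p.length = rho A x}

/-- The vertex set of the ball of radius `r` centred at the origin. -/
def ballVerts {k : ℕ} (A : Finset (Fin k → ℤ)) (r : ℕ) : Set (Fin k → ℤ) :=
  {x | rho A x ≤ r}

/-- The ball `B_r`: the subgraph of `Γ` induced by the vertices of word length at most `r`. -/
abbrev ball {k : ℕ} (A : Finset (Fin k → ℤ)) (r : ℕ) : SimpleGraph (ballVerts A r) :=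
  (Gam A).induce (ballVerts A r)

/-- The union of the vertex sets of the translated balls `B_r + x`, for `x ∈ M`. -/
def bundleVerts {k : ℕ} (A : Finset (Fin k → ℤ)) (r : ℕ) (M : Set (Fin k → ℤ)) :
    Set (Fin k → ℤ) :=
  ⋃ x ∈ M, (fun y => y + x) '' ballVerts A r

/-- The ball bundle: the subgraph of `Γ` induced by the union of the balls `B_r + x`, `x ∈ M`. -/
abbrev bundle {k : ℕ} (A : Finset (Fin k → ℤ)) (r : ℕ) (M : Set (Fin k → ℤ)) :
    SimpleGraph (bundleVerts A r M) :=
  (Gam A).induce (bundleVerts A r M)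

/-- The norm `‖A‖`: the largest absolute value of a coordinate of an element of `A`. -/
def normA {k : ℕ} (A : Finset (Fin k → ℤ)) : ℕ :=
  A.sup fun x => Finset.univ.sup fun i => (x i).natAbs

/-- `x ∈ A` is primary if for every `t ≥ 0` the element `t x` has word length `t` and is joined
to `0` by a unique shortest path. -/
def IsPrimary {k : ℕ} (A : Finset (Fin k → ℤ)) (x : Fin k → ℤ) : Prop :=
  x ∈ A ∧ ∀ t : ℕ, rho A (t • x) = t ∧ omega A (t • x) = 1

/-- `D` witnesses that every secondary (that is, non-primary) element of `A` is secondary. -/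
def DetectsSecondary {k : ℕ} (A : Finset (Fin k → ℤ)) (D : ℕ) : Prop :=
  ∀ x ∈ A, ¬ IsPrimary A x → rho A (D • x) ≠ D ∨ omega A (D • x) ≠ 1

/-- `R` is an admissible value of `R(A)`: for every `r ≥ R` each automorphism of the ball `B_r`
is the restriction of a non-degenerate linear map of `ℝᵏ`, and it has a unique extension to an
automorphism of `Γ` that fixes the origin. -/
def IsRigidRadius {k : ℕ} (A : Finset (Fin k → ℤ)) (R : ℕ) : Prop :=
  ∀ r : ℕ, R ≤ r → ∀ φ : ball A r ≃g ball A r,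
    (∃ T : (Fin k → ℝ) ≃ₗ[ℝ] (Fin k → ℝ),
      ∀ x : ballVerts A r, toReal (φ x : Fin k → ℤ) = T (toReal (x : Fin k → ℤ))) ∧
    ∃! ψ : Gam A ≃g Gam A,
      ψ 0 = 0 ∧ ∀ x : ballVerts A r, ψ (x : Fin k → ℤ) = (φ x : Fin k → ℤ)

end BallBundle

/-!
An element `x ∈ A` satisfies `rho A (t • x) = t` and `omega A (t • x) = 1` exactly when `x, …, x`
is the only word of length at most `t` with value `t • x` (`isUniqueWord_iff`). This condition
gets stronger as `t` grows, and `A` is finite, so one `D` detects all secondary elements.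

The other two parts use the larger class of rigid steps (`IsRigidStep`), the `p ∈ A` for which `p`
is the only common neighbour of `0` and `2p`, and `2p` is not adjacent to `0`. An exchange
argument (`exists_geodesic_count_le`) gives every element a geodesic word in which only rigid
steps are repeated. Hence the subgroup `L` generated by the rigid steps has finite index, and a
geodesic of more than `A.card` steps can be chosen to end with two equal rigid steps.

An automorphism `φ` of `Γ` that fixes `0` is linear. It maps a line with a rigid step to a line
with a constant step, and the images of parallel lines are parallel because they stay at bounded
distance; so `φ (v + l) = φ v + φ l` for `l ∈ L`, and `φ` agrees on `L` with a linear map `T`. As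
`φ` permutes the rigid steps, `T` has finite order and preserves an inner product. The deviation
`e = φ - T` is a function on the finite group `ℤᵏ / L`. For each `v` the vectors
`T a + e (v + a) - e v`, `a ∈ A`, are the elements of `A` again, so their squared lengths add up to
those of the `T a`. Summed over all `v`, the mixed terms telescope, which leaves
`∑ ‖e (v + a) - e v‖² = 0` (`eq_of_sum_energy_eq`), and `e` is constant.

An automorphism of a ball fixes `0`, the only vertex within distance `r` of all vertices of `B_r`,
and it preserves the smaller concentric balls. By compactness, an automorphism of a sufficiently
large ball agrees on a fixed ball `B_s` with an automorphism of `Γ`; after dividing by the latter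
it is the identity on `B_s`. If `s` is at least `A.card`, it is then the identity everywhere,
since a vertex `x` outside `B_s` is determined by its neighbours closer to `0`
(`eq_self_of_eq_self_on_ball`).

For a ball bundle, the restriction of the isomorphism to the ball about `c ∈ M` is injective and
preserves adjacency, so after translation it is an automorphism of the finite graph `B_r` and
extends to an automorphism `ψ c` of `Γ`. If `c` and `c'` are adjacent, then the ball about `c`
contains all neighbours of `c'`, so `ψ c` and `ψ c'` agree on `A` and are equal. The connectedness
of `M` then makes the isomorphism a single linear map followed by a translation
(`exists_iso_of_bundle`).
-/

namespace BallBundle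

variable {k : ℕ} {A : Finset (Fin k → ℤ)}

/-! ### Word length -/

/-- The standing hypotheses on the connection set: it is symmetric, omits `0`, and generates. -/
structure IsConnectionSet (A : Finset (Fin k → ℤ)) : Prop where
  zero_notMem : (0 : Fin k → ℤ) ∉ A
  neg_mem : ∀ x ∈ A, -x ∈ A
  closure_eq_top : AddSubgroup.closure (A : Set (Fin k → ℤ)) = ⊤

namespace IsConnectionSet

variable (hA : IsConnectionSet A)
include hA

theorem ne_zero {a : Fin k → ℤ} (ha : a ∈ A) : a ≠ 0 := fun h => hA.zero_notMem (h ▸ ha)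

theorem adj_iff {u v : Fin k → ℤ} : (Gam A).Adj u v ↔ v - u ∈ A := by
  rw [SimpleGraph.addCayley_adj']
  constructor
  · rintro ⟨-, g, hg, rfl | rfl⟩
    · simpa using hg
    · simpa using hA.neg_mem g hg
  · intro h
    refine ⟨fun huv => hA.zero_notMem (by simpa [huv] using h), v - u, h, Or.inl (by abel)⟩

theorem induction {p : (Fin k → ℤ) → Prop} (zero : p 0)
    (add : ∀ v, ∀ a ∈ A, p v → p (v + a)) (v : Fin k → ℤ) : p v := by
  have hv : v ∈ AddSubgroup.closure (A : Set (Fin k → ℤ)) := by simp [hA.closure_eq_top]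
  induction hv using AddSubgroup.closure_induction_right with
  | zero => exact zero
  | add_right x _ y hy ih => exact add x y hy ih
  | add_neg_cancel x _ y hy ih => exact add x (-y) (hA.neg_mem y hy) ih

theorem connected : (Gam A).Connected := by
  have h : ∀ v, (Gam A).Reachable 0 v := hA.induction (SimpleGraph.Reachable.refl _)
    fun v a ha hv => hv.trans (hA.adj_iff.2 (by simpa using ha) : (Gam A).Adj v (v + a)).reachable
  exact ⟨fun u v => (h u).symm.trans (h v)⟩

omit hA in
theorem rho_zero : rho A 0 = 0 := SimpleGraph.dist_self

theorem rho_eq_zero {x : Fin k → ℤ} : rho A x = 0 ↔ x = 0 := by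
  rw [rho, hA.connected.dist_eq_zero_iff, eq_comm]

theorem rho_add_le_succ {x a : Fin k → ℤ} (ha : a ∈ A) : rho A (x + a) ≤ rho A x + 1 := by
  have h : (Gam A).Adj x (x + a) := hA.adj_iff.2 (by simpa using ha)
  have := hA.connected.dist_triangle (u := 0) (v := x) (w := x + a)
  rwa [SimpleGraph.dist_eq_one_iff_adj.2 h] at this

theorem exists_rho_sub {x : Fin k → ℤ} {n : ℕ} (hx : rho A x = n + 1) :
    ∃ a ∈ A, rho A (x - a) = n := by
  obtain ⟨p, hp⟩ := hA.connected.exists_walk_length_eq_dist x 0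
  rw [SimpleGraph.dist_comm, ← rho, hx] at hp
  cases p with
  | nil => simp at hp
  | @cons _ v _ h q =>
    rw [SimpleGraph.Walk.length_cons, Nat.add_right_cancel_iff] at hp
    refine ⟨x - v, hA.adj_iff.1 h.symm, ?_⟩
    have h1 : rho A v ≤ n := by
      rw [rho, SimpleGraph.dist_comm]
      exact (SimpleGraph.dist_le q).trans hp.le
    have h2 : rho A (v + (x - v)) ≤ rho A v + 1 := hA.rho_add_le_succ (hA.adj_iff.1 h.symm)
    rw [show v + (x - v) = x by abel] at h2
    rw [show x - (x - v) = v by abel]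
    omega

theorem rho_sum_le (s : Multiset (Fin k → ℤ)) (hs : ∀ a ∈ s, a ∈ A) : rho A s.sum ≤ s.card := by
  induction s using Multiset.induction_on with
  | empty => simp [rho_zero]
  | cons a s ih =>
    have h1 := ih fun b hb => hs b (Multiset.mem_cons_of_mem hb)
    have h2 := hA.rho_add_le_succ (x := s.sum) (hs a (Multiset.mem_cons_self a s))
    rw [Multiset.sum_cons, Multiset.card_cons, add_comm a]
    omega

theorem exists_multiset (x : Fin k → ℤ) :
    ∃ s : Multiset (Fin k → ℤ), (∀ a ∈ s, a ∈ A) ∧ s.sum = x ∧ s.card = rho A x := by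
  generalize hn : rho A x = n
  induction n generalizing x with
  | zero => exact ⟨0, by simp, by simp [hA.rho_eq_zero.1 hn], by simp⟩
  | succ n ih =>
    obtain ⟨a, ha, hxa⟩ := hA.exists_rho_sub hn
    obtain ⟨s, hs, hsum, hcard⟩ := ih _ hxa
    refine ⟨a ::ₘ s, ?_, by simp [hsum], by simp [hcard]⟩
    intro b hb
    rcases Multiset.mem_cons.1 hb with rfl | hb
    exacts [ha, hs b hb]

theorem rho_eq_one {a : Fin k → ℤ} (ha : a ∈ A) : rho A a = 1 := by
  have h := hA.rho_add_le_succ (x := 0) ha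
  have h0 := mt hA.rho_eq_zero.1 (hA.ne_zero ha)
  rw [zero_add, rho_zero] at h
  omega

theorem finite_ballVerts (r : ℕ) : (ballVerts A r).Finite := by
  induction r with
  | zero =>
    refine (Set.finite_singleton 0).subset fun x hx => ?_
    exact hA.rho_eq_zero.1 (Nat.le_zero.1 hx)
  | succ r ih =>
    refine (ih.union (ih.add A.finite_toSet)).subset fun x hx => ?_
    rcases Nat.lt_or_ge r (rho A x) with h | h
    · obtain ⟨a, ha, hxa⟩ := hA.exists_rho_sub (le_antisymm hx h)
      exact Or.inr ⟨x - a, hxa.le, a, ha, by simp⟩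
    · exact Or.inl h

end IsConnectionSet

/-! ### Secondary elements -/

/-- The only word of length at most `t` with value `t • x` is the word `x, …, x`. -/
def IsUniqueWord (A : Finset (Fin k → ℤ)) (t : ℕ) (x : Fin k → ℤ) : Prop :=
  ∀ s : Multiset (Fin k → ℤ), (∀ a ∈ s, a ∈ A) → s.card ≤ t → s.sum = t • x →
    s = Multiset.replicate t x

theorem IsUniqueWord.of_le {t t' : ℕ} {x : Fin k → ℤ} (hx : x ∈ A) (h : IsUniqueWord A t' x)
    (htt : t ≤ t') : IsUniqueWord A t x := by
  intro s hs hc hsum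
  have := h (s + Multiset.replicate (t' - t) x) ?_ ?_ ?_
  · rw [← Nat.add_sub_cancel' htt, Multiset.replicate_add, Nat.add_sub_cancel_left] at this
    exact add_right_cancel this
  · intro a ha
    rcases Multiset.mem_add.1 ha with h | h
    · exact hs a h
    · rwa [Multiset.eq_of_mem_replicate h]
  · rw [Multiset.card_add, Multiset.card_replicate]; omega
  · rw [Multiset.sum_add, hsum, Multiset.sum_replicate, ← add_nsmul, Nat.add_sub_cancel' htt]

namespace IsConnectionSet

variable (hA : IsConnectionSet A)
include hA

/-- A word is the list of steps of a walk; its first letter determines the second vertex. -/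
theorem exists_walk_of_list (l : List (Fin k → ℤ)) (hl : ∀ a ∈ l, a ∈ A) (u v : Fin k → ℤ)
    (hv : u + l.sum = v) :
    ∃ p : (Gam A).Walk u v, p.length = l.length ∧
      ∀ a ∈ l.head?, p.getVert 1 = u + a := by
  induction l generalizing u with
  | nil =>
    obtain rfl : u = v := by simpa using hv
    exact ⟨SimpleGraph.Walk.nil, by simp, by simp⟩
  | cons a l ih =>
    obtain ⟨p, hp, -⟩ := ih (fun b hb => hl b (List.mem_cons_of_mem a hb)) (u + a)
      (by rw [← hv, List.sum_cons, add_assoc])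
    refine ⟨SimpleGraph.Walk.cons (hA.adj_iff.2 ?_) p, by simp [hp], by simp⟩
    simpa using hl a List.mem_cons_self

theorem exists_list_of_walk {u v : Fin k → ℤ} (p : (Gam A).Walk u v) :
    ∃ l : List (Fin k → ℤ), (∀ a ∈ l, a ∈ A) ∧ l.length = p.length ∧ v = u + l.sum ∧
      p.support = l.scanl (· + ·) u := by
  induction p with
  | nil => exact ⟨[], by simp⟩
  | @cons u v w h p ih =>
    obtain ⟨l, hl, hlen, hsum, hsupp⟩ := ih
    refine ⟨(v - u) :: l, ?_, by simp [hlen], by rw [List.sum_cons, hsum]; abel, by simp [hsupp]⟩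
    intro a ha
    rcases List.mem_cons.1 ha with rfl | ha
    exacts [hA.adj_iff.1 h, hl a ha]

theorem isUniqueWord_iff {t : ℕ} {x : Fin k → ℤ} (hx : x ∈ A) :
    rho A (t • x) = t ∧ omega A (t • x) = 1 ↔ IsUniqueWord A t x := by
  constructor
  · rintro ⟨hρ, hω⟩ s hs hc hsum
    have hct : s.card = t := le_antisymm hc (by
      have := hA.rho_sum_le s hs
      rwa [hsum, hρ] at this)
    rw [Multiset.eq_replicate]
    refine ⟨hct, fun b hb => ?_⟩
    obtain ⟨s', rfl⟩ := Multiset.exists_cons_of_mem hb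
    obtain ⟨l, rfl⟩ := Quot.exists_rep s'
    obtain ⟨t, rfl⟩ : ∃ n, t = n + 1 := ⟨l.length, by rw [← hct]; simp⟩
    obtain ⟨p, hp, hpb⟩ := hA.exists_walk_of_list (b :: l)
      (fun a ha => hs a (by simpa using ha)) 0 ((t + 1) • x) (by simpa using hsum)
    obtain ⟨q, hq, hqb⟩ := hA.exists_walk_of_list (List.replicate (t + 1) x)
      (fun a ha => by rwa [List.eq_of_mem_replicate ha]) 0 ((t + 1) • x) (by simp)
    rw [omega, Set.ncard_eq_one] at hω
    obtain ⟨w, hw⟩ := hω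
    have hmem : ∀ p : (Gam A).Walk 0 ((t + 1) • x), p.length = t + 1 → p = w := fun p hp => by
      have : p ∈ ({w} : Set _) := by
        rw [← hw]
        refine ⟨p.isPath_of_length_eq_dist ?_, by rw [hp, hρ]⟩
        rw [hp, ← rho, hρ]
      exact this
    have hpq : p = q := (hmem p (by rw [hp]; simpa using hct)).trans
      (hmem q (by rw [hq]; simp)).symm
    have h1 := hpb b (by simp)
    have h2 := hqb x (by simp [List.replicate_succ])
    rw [hpq, h2] at h1
    simpa using h1.symm
  · intro h
    have hρ : rho A (t • x) = t := by
      obtain ⟨s, hs, hsum, hcard⟩ := hA.exists_multiset (t • x)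
      have hle : rho A (t • x) ≤ t := by
        have := hA.rho_sum_le (Multiset.replicate t x)
          (fun a ha => by rwa [Multiset.eq_of_mem_replicate ha])
        simpa using this
      have := h s hs (hcard ▸ hle) hsum
      rw [← hcard, this, Multiset.card_replicate]
    refine ⟨hρ, ?_⟩
    have key : ∀ p : (Gam A).Walk 0 (t • x), p.length = t →
        p.support = (List.replicate t x).scanl (· + ·) 0 := fun p hp => by
      obtain ⟨l, hl, hlen, hsum, hsupp⟩ := hA.exists_list_of_walk p
      have := h (l : Multiset (Fin k → ℤ)) (by simpa using hl) (by simp [hlen, hp])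
        (by simpa using hsum.symm)
      have hl' : l = List.replicate t x := by
        rw [← Multiset.coe_replicate, Multiset.coe_eq_coe] at this
        exact List.perm_replicate.1 this
      rw [hsupp, hl']
    obtain ⟨w, hw⟩ := hA.connected.exists_walk_length_eq_dist 0 (t • x)
    rw [← rho, hρ] at hw
    rw [omega, Set.ncard_eq_one]
    refine ⟨w, Set.eq_singleton_iff_unique_mem.2 ⟨⟨?_, by rw [hw, hρ]⟩, ?_⟩⟩
    · exact w.isPath_of_length_eq_dist (by rw [hw, ← rho, hρ])
    · rintro p ⟨-, hp⟩
      exact SimpleGraph.Walk.ext_support ((key p (hp.trans hρ)).trans (key w hw).symm)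

theorem exists_detectsSecondary : ∃ D : ℕ, DetectsSecondary A D := by
  have h : ∀ x ∈ A, ∃ t : ℕ, ¬ IsPrimary A x → ¬ IsUniqueWord A t x := fun x hx => by
    by_cases hp : IsPrimary A x
    · exact ⟨0, fun h => (h hp).elim⟩
    · by_contra! hcon
      exact hp ⟨hx, fun t => (hA.isUniqueWord_iff hx).2 (hcon t).2⟩
  choose! t ht using h
  refine ⟨A.sup t, fun x hx hp => ?_⟩
  have h1 : ¬ IsUniqueWord A (A.sup t) x := fun h =>
    ht x hx hp (h.of_le hx (Finset.le_sup hx))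
  rw [← hA.isUniqueWord_iff hx] at h1
  tauto

end IsConnectionSet

/-! ### Rigid steps and the exchange argument -/

/-- A step `p ∈ A` is rigid if the path `0, p, 2p` is the only path of length at most two from `0`
to `2p`. Primary elements are rigid. -/
def IsRigidStep (A : Finset (Fin k → ℤ)) (p : Fin k → ℤ) : Prop :=
  p ∈ A ∧ ∀ b ∈ A, (2 • p - b ∈ A ∨ 2 • p - b = 0) → b = p

/-- The subgroup generated by the rigid steps. -/
def rigidSubgroup (A : Finset (Fin k → ℤ)) : AddSubgroup (Fin k → ℤ) :=
  AddSubgroup.closure {p | IsRigidStep A p}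

/-- The squared Euclidean norm of an integer vector. -/
def sqNorm (x : Fin k → ℤ) : ℕ := ∑ i, (x i).natAbs ^ 2

theorem sqNorm_exchange {x b : Fin k → ℤ} (hb : b ≠ x) :
    2 * sqNorm x < sqNorm b + sqNorm (2 • x - b) := by
  rw [two_nsmul]
  unfold sqNorm
  zify
  simp only [sq_abs, Pi.sub_apply, Pi.add_apply]
  rw [← Finset.sum_add_distrib, Finset.mul_sum]
  obtain ⟨j, hj⟩ := Function.ne_iff.1 hb
  refine Finset.sum_lt_sum (fun i _ => ?_) ⟨j, Finset.mem_univ j, ?_⟩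
  · nlinarith [sq_nonneg (b i - x i)]
  · have : 0 < (b j - x j) ^ 2 := by
      have := sub_ne_zero.2 hj
      positivity
    nlinarith

namespace IsConnectionSet

variable (hA : IsConnectionSet A)
include hA

/-- Every element has a geodesic word in which only rigid steps are repeated: two copies of a step
`x` that is not rigid can be replaced by `b` and `2x - b` for some `b ≠ x`, and this increases the
sum of the squared norms, so that a geodesic word with the largest such sum has the property. -/
theorem exists_geodesic_count_le (x : Fin k → ℤ) :
    ∃ s : Multiset (Fin k → ℤ), (∀ a ∈ s, a ∈ A) ∧ s.sum = x ∧ s.card = rho A x ∧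
      ∀ a ∈ s, ¬ IsRigidStep A a → s.count a ≤ 1 := by
  let V : Set ℕ := {m | ∃ s : Multiset (Fin k → ℤ), (∀ a ∈ s, a ∈ A) ∧ s.sum = x ∧
    s.card = rho A x ∧ (s.map sqNorm).sum = m}
  have hne : V.Nonempty := by
    obtain ⟨s, h1, h2, h3⟩ := hA.exists_multiset x
    exact ⟨_, s, h1, h2, h3, rfl⟩
  have hbdd : BddAbove V := by
    refine ⟨rho A x * A.sup sqNorm, ?_⟩
    rintro m ⟨s, h1, -, h3, rfl⟩
    rw [← h3, ← smul_eq_mul, ← Multiset.card_map sqNorm s]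
    refine Multiset.sum_le_card_nsmul _ _ fun y hy => ?_
    obtain ⟨a, ha, rfl⟩ := Multiset.mem_map.1 hy
    exact Finset.le_sup (h1 a ha)
  obtain ⟨s, hs, hsum, hcard, hmax⟩ := Nat.sSup_mem hne hbdd
  refine ⟨s, hs, hsum, hcard, fun a ha hr => ?_⟩
  by_contra! hcount
  obtain ⟨t, rfl⟩ : ∃ t, s = a ::ₘ a ::ₘ t := by
    obtain ⟨t, rfl⟩ := Multiset.exists_cons_of_mem ha
    rw [Multiset.count_cons_self, Nat.lt_add_left_iff_pos, Multiset.count_pos] at hcount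
    obtain ⟨t', rfl⟩ := Multiset.exists_cons_of_mem hcount
    exact ⟨t', rfl⟩
  have haA := hs a ha
  have ht : ∀ c ∈ t, c ∈ A := fun c hc => hs c (by simp [hc])
  simp only [IsRigidStep, not_and, not_forall] at hr
  obtain ⟨b, hb, hc, hba⟩ := hr haA
  rcases hc with hc | hc
  · have hmem : (((b ::ₘ (2 • a - b) ::ₘ t).map sqNorm).sum) ∈ V := by
      refine ⟨_, ?_, ?_, ?_, rfl⟩
      · intro c hct
        simp only [Multiset.mem_cons] at hct
        rcases hct with rfl | rfl | h
        exacts [hb, hc, ht c h]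
      · rw [← hsum]
        simp only [Multiset.sum_cons]
        rw [two_nsmul]
        abel
      · rw [← hcard]; simp
    have h1 := le_csSup hbdd hmem
    rw [← hmax] at h1
    have h2 := sqNorm_exchange hba
    simp only [Multiset.map_cons, Multiset.sum_cons] at h1
    omega
  · have h1 := hA.rho_sum_le (b ::ₘ t) (fun c hct => by
      rcases Multiset.mem_cons.1 hct with rfl | h
      exacts [hb, ht c h])
    have h2 : (b ::ₘ t).sum = x := by
      rw [← hsum]
      simp only [Multiset.sum_cons]
      rw [← sub_eq_zero.1 hc, two_nsmul]
      abel
    rw [h2, ← hcard] at h1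
    simp at h1

/-- A long geodesic can be chosen to end with two equal rigid steps. -/
theorem exists_rigidStep_rho_sub {x : Fin k → ℤ} (hx : A.card < rho A x) :
    ∃ p, IsRigidStep A p ∧ rho A (x - 2 • p) + 2 = rho A x ∧ rho A (x - p) + 1 = rho A x := by
  obtain ⟨s, hs, hsum, hcard, hcount⟩ := hA.exists_geodesic_count_le x
  by_cases hnd : s.Nodup
  · have : (⟨s, hnd⟩ : Finset (Fin k → ℤ)).card ≤ A.card :=
      Finset.card_le_card fun a ha => hs a ha
    rw [Finset.card_mk, hcard] at this
    omega
  rw [Multiset.nodup_iff_ne_cons_cons] at hnd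
  push Not at hnd
  obtain ⟨p, t, rfl⟩ := hnd
  have hpA : p ∈ A := hs p (by simp)
  have hp : IsRigidStep A p := by
    by_contra hp
    have := hcount p (by simp) hp
    simp at this
  have h1 := hA.rho_sum_le t fun a ha => hs a (by simp [ha])
  have h2 := hA.rho_add_le_succ (x := t.sum) hpA
  have h3 := hA.rho_add_le_succ (x := t.sum + p) hpA
  have hx2 : t.sum + p + p = x := by
    rw [← hsum]
    simp only [Multiset.sum_cons]
    abel
  rw [hx2] at h3
  simp only [Multiset.card_cons] at hcard
  refine ⟨p, hp, ?_, ?_⟩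
  · rw [show x - 2 • p = t.sum by rw [← hx2, two_nsmul]; abel]
    omega
  · rw [show x - p = t.sum + p by rw [← hx2]; abel]
    omega

theorem finite_quotient_rigidSubgroup : Finite ((Fin k → ℤ) ⧸ rigidSubgroup A) := by
  classical
  refine Finite.of_surjective
    (fun F : A.powerset => ((∑ a ∈ F.1, a : Fin k → ℤ) : (Fin k → ℤ) ⧸ rigidSubgroup A)) ?_
  intro y
  obtain ⟨x, rfl⟩ := QuotientAddGroup.mk_surjective y
  obtain ⟨s, hs, hsum, -, hcount⟩ := hA.exists_geodesic_count_le x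
  have hnd : (s.filter fun a => ¬ IsRigidStep A a).Nodup := by
    rw [Multiset.nodup_iff_count_le_one]
    intro a
    by_cases ha : a ∈ s.filter fun a => ¬ IsRigidStep A a
    · rw [Multiset.mem_filter] at ha
      exact (Multiset.count_le_of_le a (Multiset.filter_le _ _)).trans (hcount a ha.1 ha.2)
    · rw [Multiset.count_eq_zero_of_notMem ha]
      exact zero_le_one
  refine ⟨⟨⟨_, hnd⟩, ?_⟩, ?_⟩
  · rw [Finset.mem_powerset]
    exact fun a ha => hs a (Multiset.mem_filter.1 ha).1
  · have h1 := congrArg Multiset.sum (Multiset.filter_add_not (fun a => IsRigidStep A a) s)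
    rw [Multiset.sum_add, hsum] at h1
    rw [QuotientAddGroup.eq, ← h1, Finset.sum_mk, Multiset.map_id', neg_add_eq_sub,
      add_sub_cancel_right]
    exact AddSubgroup.multiset_sum_mem _ _ fun a ha =>
      AddSubgroup.subset_closure (Multiset.mem_filter.1 ha).2

end IsConnectionSet

/-! ### Automorphisms of the Cayley graph -/

namespace IsConnectionSet

variable (hA : IsConnectionSet A) (φ : Gam A ≃g Gam A)
include hA

theorem map_sub_mem_iff {u v : Fin k → ℤ} : φ v - φ u ∈ A ↔ v - u ∈ A := by
  rw [← hA.adj_iff, ← hA.adj_iff, φ.map_adj_iff]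

theorem map_add_sub_mem (v : Fin k → ℤ) {a : Fin k → ℤ} (ha : a ∈ A) : φ (v + a) - φ v ∈ A := by
  rw [hA.map_sub_mem_iff]
  simpa using ha

/-- Rigid lines are mapped to lines with constant step. -/
theorem map_add_two_nsmul {p : Fin k → ℤ} (hp : IsRigidStep A p) (v : Fin k → ℤ) :
    φ (v + p + p) - φ (v + p) = φ (v + p) - φ v := by
  -- the fourth vertex of the parallelogram is a common neighbour of the images of the end points
  obtain ⟨w, hw⟩ := φ.surjective (φ v + (φ (v + p + p) - φ (v + p)))
  have h1 : w - v ∈ A := by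
    rw [← hA.map_sub_mem_iff φ, hw, add_sub_cancel_left]
    exact hA.map_add_sub_mem φ _ hp.1
  have h2 : v + p + p - w ∈ A := by
    rw [← hA.map_sub_mem_iff φ, hw]
    have := hA.map_add_sub_mem φ v hp.1
    convert this using 1
    abel
  have h3 := hp.2 _ h1 (Or.inl (by convert h2 using 1; rw [two_nsmul]; abel))
  rw [sub_eq_iff_eq_add'] at h3
  rw [h3] at hw
  exact eq_sub_iff_add_eq'.2 hw.symm

theorem map_add_nsmul {p : Fin k → ℤ} (hp : IsRigidStep A p) (v : Fin k → ℤ) (t : ℕ) :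
    φ (v + t • p) = φ v + t • (φ (v + p) - φ v) := by
  have key : ∀ t : ℕ, φ (v + t • p + p) - φ (v + t • p) = φ (v + p) - φ v := fun t => by
    induction t with
    | zero => simp
    | succ t ih =>
      rw [succ_nsmul, ← add_assoc, hA.map_add_two_nsmul φ hp, ih]
  induction t with
  | zero => simp
  | succ t ih =>
    rw [succ_nsmul, ← add_assoc, sub_eq_iff_eq_add'.1 (key t), ih, succ_nsmul, add_assoc]

/-- Parallel rigid lines have parallel images, since these stay at bounded distance. -/
theorem map_add_rigidStep {p : Fin k → ℤ} (hp : IsRigidStep A p) (h0 : φ 0 = 0)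
    (v : Fin k → ℤ) : φ (v + p) = φ v + φ p := by
  rw [← sub_eq_iff_eq_add']
  refine hA.induction (p := fun v => φ (v + p) - φ v = φ p) (by simp [h0]) (fun v a ha ih => ?_) v
  rw [← ih]
  by_contra hne
  have hc : φ (v + a + p) - φ (v + a) - (φ (v + p) - φ v) ≠ 0 := sub_ne_zero.2 hne
  have hinj : ∀ c : Fin k → ℤ, c ≠ 0 → Function.Injective fun t : ℕ => t • c :=
    fun c hc s t h => by
      have h' : (s : ℤ) • c = (t : ℤ) • c := by simpa only [natCast_zsmul] using h
      exact_mod_cast smul_left_injective ℤ hc h'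
  refine Set.infinite_range_of_injective (hinj _ hc)
    ((A.finite_toSet.sub A.finite_toSet).subset ?_)
  rintro _ ⟨t, rfl⟩
  refine ⟨_, hA.map_add_sub_mem φ (v + t • p) ha, _, hA.map_add_sub_mem φ v ha, ?_⟩
  simp only
  rw [add_right_comm v, hA.map_add_nsmul φ hp, hA.map_add_nsmul φ hp]
  simp only [nsmul_sub]
  abel

theorem map_add_of_mem_rigidSubgroup (h0 : φ 0 = 0) {l : Fin k → ℤ} (hl : l ∈ rigidSubgroup A) :
    ∀ v, φ (v + l) = φ v + φ l := by
  induction hl using AddSubgroup.closure_induction with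
  | mem p hp => exact hA.map_add_rigidStep φ hp h0
  | zero => simp [h0]
  | add x y _ _ hx hy => intro v; rw [← add_assoc, hy, hx, hy, add_assoc]
  | neg x _ hx =>
    have h : ∀ v, φ (v + -x) = φ v - φ x := fun v => by
      rw [eq_sub_iff_add_eq, ← hx, neg_add_cancel_right]
    intro v
    have h' := h 0
    rw [zero_add, h0, zero_sub] at h'
    rw [h, h', sub_eq_add_neg]

theorem map_isRigidStep (h0 : φ 0 = 0) {p : Fin k → ℤ} (hp : IsRigidStep A p) :
    IsRigidStep A (φ p) := by
  have h2 : φ (2 • p) = 2 • φ p := by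
    rw [two_nsmul, hA.map_add_rigidStep φ hp h0, two_nsmul]
  refine ⟨by simpa [h0] using hA.map_add_sub_mem φ 0 hp.1, fun b hb hc => ?_⟩
  obtain ⟨w, rfl⟩ := φ.surjective b
  rw [← h2] at hc
  congr 1
  refine hp.2 w ?_ ?_
  · have := hA.map_sub_mem_iff φ (u := 0) (v := w)
    simpa [h0, hb] using this
  · rw [hA.map_sub_mem_iff, sub_eq_zero, φ.injective.eq_iff, ← sub_eq_zero] at hc
    exact hc

end IsConnectionSet

/-! ### Linearity of automorphisms that fix the origin -/

theorem toReal_zero : toReal (0 : Fin k → ℤ) = 0 := by ext; simp [toReal]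

theorem toReal_add (x y : Fin k → ℤ) : toReal (x + y) = toReal x + toReal y := by
  ext; simp [toReal]

theorem toReal_neg (x : Fin k → ℤ) : toReal (-x) = -toReal x := by ext; simp [toReal]

theorem toReal_sub (x y : Fin k → ℤ) : toReal (x - y) = toReal x - toReal y := by
  ext; simp [toReal]

theorem toReal_nsmul (n : ℕ) (x : Fin k → ℤ) : toReal (n • x) = (n : ℝ) • toReal x := by
  ext; simp [toReal]

theorem toReal_injective : Function.Injective (toReal : (Fin k → ℤ) → Fin k → ℝ) :=
  fun x y h => funext fun i => by simpa [toReal] using congrFun h i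

theorem basisFun_eq_toReal (i : Fin k) :
    Pi.basisFun ℝ (Fin k) i = toReal (Pi.single i 1) := by
  ext j
  rw [Pi.basisFun_apply]
  rcases eq_or_ne j i with rfl | h
  · simp [toReal]
  · simp [toReal, h]

theorem linearMap_ext_toReal {V : Type*} [AddCommGroup V] [Module ℝ V]
    {S T : (Fin k → ℝ) →ₗ[ℝ] V} (h : ∀ z, S (toReal z) = T (toReal z)) : S = T :=
  (Pi.basisFun ℝ (Fin k)).ext fun i => by rw [basisFun_eq_toReal, h]

theorem IsConnectionSet.linearMap_ext (hA : IsConnectionSet A) {V : Type*} [AddCommGroup V]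
    [Module ℝ V] {S T : (Fin k → ℝ) →ₗ[ℝ] V} (h : ∀ a ∈ A, S (toReal a) = T (toReal a)) :
    S = T := by
  refine linearMap_ext_toReal (hA.induction ?_ fun v a ha hv => ?_)
  · rw [toReal_zero, map_zero, map_zero]
  · rw [toReal_add, map_add, map_add, hv, h a ha]

/-- An additive map on `ℤᵏ` extends to a linear map on `ℝᵏ`. -/
theorem exists_linearMap_toReal (f : (Fin k → ℤ) →+ (Fin k → ℝ)) :
    ∃ T : (Fin k → ℝ) →ₗ[ℝ] (Fin k → ℝ), ∀ z, T (toReal z) = f z := by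
  let T := (Pi.basisFun ℝ (Fin k)).constr ℝ fun i => f (Pi.single i 1)
  let g : (Fin k → ℤ) →+ (Fin k → ℝ) :=
    { toFun := fun z => T (toReal z)
      map_zero' := by rw [toReal_zero, map_zero]
      map_add' := fun x y => by rw [toReal_add, map_add] }
  have hgf : g = f := by
    refine AddMonoidHom.functions_ext' _ _ _ fun i => ?_
    ext1
    change T (toReal (Pi.single i 1)) = f (Pi.single i 1)
    rw [← basisFun_eq_toReal, Module.Basis.constr_basis]
  exact ⟨T, fun z => DFunLike.congr_fun hgf z⟩

/-- Let `e` be a function on a finite abelian group, and let each `g a` be as long as `f a`. If for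
every `v` the vectors `g a + (e (v + π a) - e v)` have the same total squared length as the `f a`,
then `e` is invariant under translation by the `π a`: summed over `v`, the terms linear in the
differences of `e` telescope, so the total squared length of these differences is zero. -/
theorem eq_of_sum_energy_eq {Q ι V : Type*} [AddCommGroup Q] [Fintype Q] [AddCommGroup V]
    [Module ℝ V] (B : V →ₗ[ℝ] V →ₗ[ℝ] ℝ) (hsymm : ∀ x y, B x y = B y x)
    (hnonneg : ∀ x, 0 ≤ B x x) (hdef : ∀ x, B x x = 0 → x = 0)
    (s : Finset ι) (f g : ι → V) (π : ι → Q) (hfg : ∀ a ∈ s, B (g a) (g a) = B (f a) (f a))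
    (e : Q → V)
    (h : ∀ v, ∑ a ∈ s, B (g a + (e (v + π a) - e v)) (g a + (e (v + π a) - e v)) =
      ∑ a ∈ s, B (f a) (f a)) :
    ∀ a ∈ s, ∀ v, e (v + π a) = e v := by
  have htel : ∀ a, ∑ v, (e (v + π a) - e v) = 0 := fun a => by
    rw [Finset.sum_sub_distrib, sub_eq_zero]
    exact Fintype.sum_equiv (Equiv.addRight (π a)) _ _ fun v => rfl
  have hexp : ∀ a v, B (g a + (e (v + π a) - e v)) (g a + (e (v + π a) - e v)) =
      B (g a) (g a) + (2 * B (g a) (e (v + π a) - e v) +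
        B (e (v + π a) - e v) (e (v + π a) - e v)) := fun a v => by
    rw [map_add, map_add, LinearMap.add_apply, LinearMap.add_apply,
      hsymm (e (v + π a) - e v) (g a)]
    ring
  have hzero : ∑ a ∈ s, ∑ v, B (e (v + π a) - e v) (e (v + π a) - e v) = 0 := by
    have h1 : ∀ v, ∑ a ∈ s, (2 * B (g a) (e (v + π a) - e v) +
        B (e (v + π a) - e v) (e (v + π a) - e v)) = 0 := fun v => by
      have h2 := h v
      simp_rw [hexp] at h2
      rw [Finset.sum_add_distrib, Finset.sum_congr rfl hfg] at h2
      linarith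
    have h3 : ∑ v, ∑ a ∈ s, (2 * B (g a) (e (v + π a) - e v) +
        B (e (v + π a) - e v) (e (v + π a) - e v)) = 0 :=
      Finset.sum_eq_zero fun v _ => h1 v
    rw [Finset.sum_comm] at h3
    rw [← h3]
    refine Finset.sum_congr rfl fun a _ => ?_
    rw [Finset.sum_add_distrib, ← Finset.mul_sum, ← map_sum, htel, map_zero, mul_zero, zero_add]
  intro a ha v
  rw [Finset.sum_eq_zero_iff_of_nonneg fun a _ => Finset.sum_nonneg fun v _ => hnonneg _] at hzero
  have h4 := hzero a ha
  rw [Finset.sum_eq_zero_iff_of_nonneg fun v _ => hnonneg _] at h4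
  exact sub_eq_zero.1 (hdef _ (h4 v (Finset.mem_univ v)))

/-- A linear map of finite order preserves an inner product. -/
theorem exists_invariant_form {T : (Fin k → ℝ) →ₗ[ℝ] (Fin k → ℝ)} {n : ℕ} (hn : 0 < n)
    (hT : T ^ n = 1) :
    ∃ B : (Fin k → ℝ) →ₗ[ℝ] (Fin k → ℝ) →ₗ[ℝ] ℝ, (∀ x y, B x y = B y x) ∧
      (∀ x, 0 ≤ B x x) ∧ (∀ x, B x x = 0 → x = 0) ∧ ∀ x, B (T x) (T x) = B x x := by
  let B : (Fin k → ℝ) →ₗ[ℝ] (Fin k → ℝ) →ₗ[ℝ] ℝ :=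
    ∑ j ∈ Finset.range n, (dotProductBilin ℝ ℝ).compl₁₂ (T ^ j) (T ^ j)
  have hB : ∀ x y, B x y = ∑ j ∈ Finset.range n, (T ^ j) x ⬝ᵥ (T ^ j) y := fun x y => by
    simp [B]
  have hpos : ∀ x : Fin k → ℝ, 0 ≤ x ⬝ᵥ x := fun x =>
    Finset.sum_nonneg fun i _ => mul_self_nonneg _
  refine ⟨B, fun x y => ?_, fun x => ?_, fun x hx => ?_, fun x => ?_⟩
  · simp only [hB, dotProduct_comm]
  · rw [hB]
    exact Finset.sum_nonneg fun j _ => hpos _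
  · rw [hB, Finset.sum_eq_zero_iff_of_nonneg fun j _ => hpos _] at hx
    have := hx 0 (Finset.mem_range.2 hn)
    rwa [dotProduct_self_eq_zero] at this
  · have h1 : ∀ j, (T ^ j) (T x) = (T ^ (j + 1)) x := fun j => by rw [pow_succ]; rfl
    simp only [hB, h1]
    have h2 := Finset.sum_range_succ (fun j => (T ^ j) x ⬝ᵥ (T ^ j) x) n
    rw [Finset.sum_range_succ', hT, pow_zero] at h2
    exact add_right_cancel h2

namespace IsConnectionSet

variable (hA : IsConnectionSet A) (φ : Gam A ≃g Gam A)
include hA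

theorem exists_linearMap_eq_on_rigidSubgroup (h0 : φ 0 = 0) :
    ∃ T : (Fin k → ℝ) →ₗ[ℝ] (Fin k → ℝ), ∀ l ∈ rigidSubgroup A, T (toReal l) = toReal (φ l) := by
  have := hA.finite_quotient_rigidSubgroup
  have hindex : (rigidSubgroup A).index ≠ 0 := Nat.card_pos.ne'
  let N := (rigidSubgroup A).index
  have hmem : ∀ z, N • z ∈ rigidSubgroup A := fun z => AddSubgroup.nsmul_index_mem _ z
  have hadd := fun l hl => hA.map_add_of_mem_rigidSubgroup φ h0 (l := l) hl
  obtain ⟨T, hT⟩ := exists_linearMap_toReal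
    { toFun := fun z => (N : ℝ)⁻¹ • toReal (φ (N • z))
      map_zero' := by rw [nsmul_zero, h0, toReal_zero, smul_zero]
      map_add' := fun x y => by rw [nsmul_add, hadd _ (hmem y), toReal_add, smul_add] }
  refine ⟨T, fun l hl => ?_⟩
  have hmul : ∀ n : ℕ, φ (n • l) = n • φ l := fun n => by
    induction n with
    | zero => simp [h0]
    | succ n ih => rw [succ_nsmul, hadd l hl, ih, succ_nsmul]
  rw [hT]
  change (N : ℝ)⁻¹ • toReal (φ (N • l)) = _
  rw [hmul, toReal_nsmul, smul_smul, inv_mul_cancel₀ (Nat.cast_ne_zero.2 hindex), one_smul]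

theorem map_mem_iff (h0 : φ 0 = 0) {a : Fin k → ℤ} : φ a ∈ A ↔ a ∈ A := by
  simpa [h0] using hA.map_sub_mem_iff φ (u := 0) (v := a)

/-- A linear map that agrees with `φ` on the rigid subgroup permutes the finitely many rigid steps,
which span `ℝᵏ`, so that it has finite order. -/
theorem exists_pow_eq_one (h0 : φ 0 = 0) {T : (Fin k → ℝ) →ₗ[ℝ] (Fin k → ℝ)}
    (hT : ∀ l ∈ rigidSubgroup A, T (toReal l) = toReal (φ l)) : ∃ n, 0 < n ∧ T ^ n = 1 := by
  have hfin := hA.finite_quotient_rigidSubgroup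
  have hindex : (rigidSubgroup A).index ≠ 0 := Nat.card_pos.ne'
  let σ : Equiv.Perm A := Equiv.Perm.subtypePerm φ.toEquiv fun a => hA.map_mem_iff φ h0
  have hiter : ∀ j, ∀ p (hp : IsRigidStep A p), IsRigidStep A ((σ ^ j) ⟨p, hp.1⟩).1 ∧
      (T ^ j) (toReal p) = toReal ((σ ^ j) ⟨p, hp.1⟩).1 := fun j => by
    induction j with
    | zero => exact fun p hp => ⟨hp, rfl⟩
    | succ j ih =>
      intro p hp
      obtain ⟨h1, h2⟩ := ih p hp
      have h3 : ((σ ^ (j + 1)) ⟨p, hp.1⟩).1 = φ ((σ ^ j) ⟨p, hp.1⟩).1 := by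
        rw [pow_succ']
        rfl
      rw [h3]
      refine ⟨hA.map_isRigidStep φ h0 h1, ?_⟩
      rw [pow_succ', Module.End.mul_apply, h2, hT _ (AddSubgroup.subset_closure h1)]
  refine ⟨orderOf σ, orderOf_pos σ, ?_⟩
  have hL : ∀ l ∈ rigidSubgroup A, (T ^ orderOf σ) (toReal l) = toReal l := fun l hl => by
    induction hl using AddSubgroup.closure_induction with
    | mem p hp => rw [(hiter _ p hp).2, pow_orderOf_eq_one]; rfl
    | zero => rw [toReal_zero, map_zero]
    | add x y _ _ hx hy => rw [toReal_add, map_add, hx, hy]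
    | neg x _ hx => rw [toReal_neg, map_neg, hx]
  refine linearMap_ext_toReal fun z => ?_
  have h := hL _ (AddSubgroup.nsmul_index_mem (rigidSubgroup A) z)
  rw [toReal_nsmul, map_smul] at h
  exact smul_right_injective _ (Nat.cast_ne_zero.2 hindex) h

theorem exists_linearMap (h0 : φ 0 = 0) :
    ∃ T : (Fin k → ℝ) →ₗ[ℝ] (Fin k → ℝ), ∀ x, T (toReal x) = toReal (φ x) := by
  obtain ⟨T, hT⟩ := hA.exists_linearMap_eq_on_rigidSubgroup φ h0
  obtain ⟨n, hn, hTn⟩ := hA.exists_pow_eq_one φ h0 hT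
  obtain ⟨B, hsymm, hnonneg, hdef, hinv⟩ := exists_invariant_form hn hTn
  have := hA.finite_quotient_rigidSubgroup
  have := Fintype.ofFinite ((Fin k → ℤ) ⧸ rigidSubgroup A)
  -- the deviation of `φ` from `T` is a function on the finite group `ℤᵏ / L`
  let d : (Fin k → ℤ) → Fin k → ℝ := fun x => toReal (φ x) - T (toReal x)
  have hd : ∀ x y, -x + y ∈ rigidSubgroup A → d x = d y := fun x y hxy => by
    obtain ⟨l, hl, rfl⟩ : ∃ l ∈ rigidSubgroup A, y = x + l := ⟨-x + y, hxy, by abel⟩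
    simp only [d]
    rw [hA.map_add_of_mem_rigidSubgroup φ h0 hl, toReal_add, toReal_add, map_add, hT l hl]
    abel
  let e : (Fin k → ℤ) ⧸ rigidSubgroup A → Fin k → ℝ := fun q =>
    Quotient.liftOn' q d fun x y hxy => hd x y (QuotientAddGroup.leftRel_apply.1 hxy)
  have he : ∀ a ∈ A, ∀ q, e (q + (a : (Fin k → ℤ) ⧸ rigidSubgroup A)) = e q := by
    refine eq_of_sum_energy_eq B hsymm hnonneg hdef A toReal (fun a => T (toReal a)) _
      (fun a _ => hinv _) e fun q => ?_
    obtain ⟨v, rfl⟩ := QuotientAddGroup.mk_surjective q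
    refine Finset.sum_bij (fun a _ => φ (v + a) - φ v) (fun a ha => hA.map_add_sub_mem φ v ha)
      (fun a _ b _ hab => ?_) (fun b hb => ?_) fun a ha => ?_
    · exact add_left_cancel (φ.injective (sub_left_injective hab))
    · obtain ⟨w, hw⟩ := φ.surjective (φ v + b)
      refine ⟨w - v, ?_, ?_⟩
      · rwa [← hA.map_sub_mem_iff φ, hw, add_sub_cancel_left]
      · rw [add_sub_cancel, hw, add_sub_cancel_left]
    · have : T (toReal a) + (d (v + a) - d v) = toReal (φ (v + a) - φ v) := by
        simp only [d]
        rw [toReal_add, T.map_add, toReal_sub]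
        abel
      rw [← this]
      rfl
  refine ⟨T, fun x => (sub_eq_zero.1 ?_).symm⟩
  change d x = 0
  refine hA.induction (p := fun x => d x = 0) ?_ (fun v a ha hv => ?_) x
  · simp [d, h0, toReal_zero]
  · exact (he a ha v).trans hv

/-- An automorphism of the Cayley graph that fixes the origin is linear. -/
theorem exists_linearEquiv (h0 : φ 0 = 0) :
    ∃ T : (Fin k → ℝ) ≃ₗ[ℝ] (Fin k → ℝ), ∀ x, toReal (φ x) = T (toReal x) := by
  obtain ⟨T, hT⟩ := hA.exists_linearMap φ h0
  obtain ⟨S, hS⟩ := hA.exists_linearMap φ.symm 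
    (φ.injective (by rw [RelIso.apply_symm_apply, h0]))
  refine ⟨LinearEquiv.ofLinearMap T S ?_ ?_, fun x => (hT x).symm⟩
  · exact linearMap_ext_toReal fun z => by simp [hS, hT]
  · exact linearMap_ext_toReal fun z => by simp [hS, hT]

theorem map_add_of_map_zero (h0 : φ 0 = 0) (x y : Fin k → ℤ) : φ (x + y) = φ x + φ y := by
  obtain ⟨T, hT⟩ := hA.exists_linearMap φ h0
  apply toReal_injective
  rw [toReal_add, ← hT, ← hT, ← hT, toReal_add, map_add]

end IsConnectionSet

/-! ### Automorphisms of balls -/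

open Classical in
/-- The map on `ℤᵏ` that agrees with `φ` on the ball and is the identity outside it. -/
noncomputable def extendBall {r : ℕ} (φ : ball A r ≃g ball A r) (x : Fin k → ℤ) : Fin k → ℤ :=
  if h : x ∈ ballVerts A r then φ ⟨x, h⟩ else x

theorem extendBall_of_mem {r : ℕ} (φ : ball A r ≃g ball A r) (x : ballVerts A r) :
    extendBall φ x = φ x := dif_pos x.2

theorem extendBall_mem {r : ℕ} (φ : ball A r ≃g ball A r) {x : Fin k → ℤ}
    (hx : x ∈ ballVerts A r) : extendBall φ x ∈ ballVerts A r := by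
  rw [extendBall_of_mem φ ⟨x, hx⟩]
  exact (φ ⟨x, hx⟩).2

theorem extendBall_symm_extendBall {r : ℕ} (φ : ball A r ≃g ball A r) {x : Fin k → ℤ}
    (hx : x ∈ ballVerts A r) : extendBall φ.symm (extendBall φ x) = x := by
  rw [extendBall_of_mem φ ⟨x, hx⟩, extendBall_of_mem, RelIso.symm_apply_apply]

theorem extendBall_extendBall_symm {r : ℕ} (φ : ball A r ≃g ball A r) {x : Fin k → ℤ}
    (hx : x ∈ ballVerts A r) : extendBall φ (extendBall φ.symm x) = x :=
  extendBall_symm_extendBall φ.symm hx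

namespace IsConnectionSet

variable (hA : IsConnectionSet A)
include hA

theorem extendBall_sub_mem_iff {r : ℕ} (φ : ball A r ≃g ball A r) {x y : Fin k → ℤ}
    (hx : x ∈ ballVerts A r) (hy : y ∈ ballVerts A r) :
    extendBall φ y - extendBall φ x ∈ A ↔ y - x ∈ A := by
  rw [extendBall_of_mem φ ⟨x, hx⟩, extendBall_of_mem φ ⟨y, hy⟩, ← hA.adj_iff, ← hA.adj_iff]
  exact φ.map_adj_iff (v := ⟨x, hx⟩) (w := ⟨y, hy⟩)

/-- Geodesics from the origin stay in the ball, so an adjacency-preserving map on the ball does not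
increase the distance to the origin. -/
theorem rho_map_sub_le {r : ℕ} {f : (Fin k → ℤ) → Fin k → ℤ}
    (hf : ∀ x ∈ ballVerts A r, ∀ y ∈ ballVerts A r, y - x ∈ A → f y - f x ∈ A)
    {x : Fin k → ℤ} (hx : x ∈ ballVerts A r) : rho A (f x - f 0) ≤ rho A x := by
  generalize hn : rho A x = n
  induction n generalizing x with
  | zero => rw [hA.rho_eq_zero.1 hn, sub_self, rho_zero]
  | succ n ih =>
    obtain ⟨a, ha, hxa⟩ := hA.exists_rho_sub hn
    have hmem : x - a ∈ ballVerts A r := by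
      have : rho A x ≤ r := hx
      change rho A (x - a) ≤ r
      omega
    have h1 := hf _ hmem _ hx (by simpa using ha)
    have h2 := hA.rho_add_le_succ (x := f (x - a) - f 0) h1
    rw [show f (x - a) - f 0 + (f x - f (x - a)) = f x - f 0 by abel] at h2
    have := ih hmem hxa
    omega

/-- The origin is the only vertex within distance `r` of all vertices of the ball `B_r`. If
`v i ≠ 0`, then a vertex too far from `v` is `r • a`, where `a ∈ A` maximizes the functional
`x ↦ -(v i * x i)`, which is negative at `v`. -/
theorem exists_rho_sub_gt {v : Fin k → ℤ} (hv : v ≠ 0) (r : ℕ) :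
    ∃ w, rho A w ≤ r ∧ r < rho A (w - v) := by
  obtain ⟨i, hi⟩ := Function.ne_iff.1 hv
  have hne : A.Nonempty := by
    by_contra h
    rw [Finset.not_nonempty_iff_eq_empty] at h
    obtain ⟨s, hs, hsum, -⟩ := hA.exists_multiset v
    have hs0 : s = 0 := Multiset.eq_zero_of_forall_notMem fun a ha => by simpa [h] using hs a ha
    rw [hs0] at hsum
    exact hv hsum.symm
  obtain ⟨a, ha, hmax⟩ := A.exists_max_image (fun x => -(v i * x i)) hne
  have ha0 : 0 ≤ -(v i * a i) := by
    have := hmax _ (hA.neg_mem a ha)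
    simp only [Pi.neg_apply] at this
    linarith
  have hword : ∀ s : Multiset (Fin k → ℤ), (∀ x ∈ s, x ∈ A) →
      -(v i * s.sum i) ≤ s.card * -(v i * a i) := fun s => by
    induction s using Multiset.induction_on with
    | empty => simp
    | cons b s ih =>
      intro hs
      have h1 := ih fun x hx => hs x (Multiset.mem_cons_of_mem hx)
      have h2 := hmax b (hs b (Multiset.mem_cons_self b s))
      rw [Multiset.sum_cons, Multiset.card_cons, Pi.add_apply]
      push_cast
      linarith
  refine ⟨r • a, ?_, ?_⟩
  · have := hA.rho_sum_le (Multiset.replicate r a)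
      (fun b hb => by rwa [Multiset.eq_of_mem_replicate hb])
    simpa using this
  · by_contra! hle
    obtain ⟨s, hs, hsum, hcard⟩ := hA.exists_multiset (r • a - v)
    have h1 := hword s hs
    rw [hsum, hcard] at h1
    have h2 : (rho A (r • a - v) : ℤ) * -(v i * a i) ≤ r * -(v i * a i) :=
      mul_le_mul_of_nonneg_right (by exact_mod_cast hle) ha0
    have h3 : 0 < v i * v i := mul_self_pos.2 hi
    have h4 : (r • a - v) i = r * a i - v i := by simp
    rw [h4] at h1
    linarith

theorem extendBall_zero {r : ℕ} (φ : ball A r ≃g ball A r) : extendBall φ 0 = 0 := by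
  by_contra h0
  obtain ⟨w, hw, hfar⟩ := hA.exists_rho_sub_gt h0 r
  have h := hA.rho_map_sub_le (r := r) (f := extendBall φ)
    (fun x hx y hy => (hA.extendBall_sub_mem_iff φ hx hy).2)
    (extendBall_mem φ.symm hw)
  rw [extendBall_extendBall_symm φ hw] at h
  have h2 : rho A (extendBall φ.symm w) ≤ r := extendBall_mem φ.symm hw
  omega

theorem rho_extendBall_le {r : ℕ} (φ : ball A r ≃g ball A r) {x : Fin k → ℤ}
    (hx : x ∈ ballVerts A r) : rho A (extendBall φ x) ≤ rho A x := by
  have h := hA.rho_map_sub_le (r := r) (f := extendBall φ)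
    (fun x hx y hy => (hA.extendBall_sub_mem_iff φ hx hy).2) hx
  rwa [hA.extendBall_zero, sub_zero] at h

/-- A vertex `x` outside a large ball is determined by its neighbours closer to the origin: there is
a geodesic to `x` that ends with two equal rigid steps `p`, and `x - p` is the only common neighbour
of `x - 2p` and `x`. -/
theorem eq_self_of_eq_self_on_ball {r : ℕ} {f : (Fin k → ℤ) → Fin k → ℤ}
    (hf : ∀ x ∈ ballVerts A r, ∀ y ∈ ballVerts A r, (f y - f x ∈ A ↔ y - x ∈ A))
    (hid : ∀ x, rho A x ≤ A.card → f x = x) {x : Fin k → ℤ} (hx : x ∈ ballVerts A r) :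
    f x = x := by
  induction hn : rho A x using Nat.strong_induction_on generalizing x with
  | _ n ih =>
  rcases Nat.lt_or_ge A.card (rho A x) with hlt | hle
  swap
  · exact hid x hle
  have hxr : rho A x ≤ r := hx
  have hlow : ∀ y, rho A y < n → y ∈ ballVerts A r ∧ f y = y := fun y hy => by
    have hyr : y ∈ ballVerts A r := by
      change rho A y ≤ r
      omega
    exact ⟨hyr, ih _ hy hyr rfl⟩
  obtain ⟨p, hp, hp2, hp1⟩ := hA.exists_rigidStep_rho_sub hlt
  obtain ⟨h1, h1f⟩ := hlow (x - p) (by omega)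
  have hb : f x - (x - p) ∈ A := by
    have := (hf _ h1 _ hx).2 (by simpa using hp.1)
    rwa [h1f] at this
  have hw := hA.rho_add_le_succ (x := x - 2 • p) hb
  obtain ⟨h2, h2f⟩ := hlow (x - 2 • p + (f x - (x - p))) (by omega)
  have hc := (hf _ h2 _ hx).1 (by
    rw [h2f]
    convert hp.1 using 1
    rw [two_nsmul]
    abel)
  have := hp.2 _ hb (Or.inl (by convert hc using 1; abel))
  rw [sub_eq_iff_eq_add'] at this
  rw [this, sub_add_cancel]

open Filter in
/-- Compactness: on a fixed ball `B_s` every automorphism of a sufficiently large ball agrees with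
an automorphism of the whole graph. Otherwise an ultrafilter limit of counterexamples would be an
automorphism that agrees with one of them on `B_s`. -/
theorem exists_radius_forall_exists_iso (s : ℕ) :
    ∃ R, ∀ r, R ≤ r → ∀ φ : ball A r ≃g ball A r, ∃ ψ : Gam A ≃g Gam A,
      ψ 0 = 0 ∧ ∀ x ∈ ballVerts A s, ψ x = extendBall φ x := by
  by_contra! hcon
  choose r hr φ hφ using hcon
  have hlarge : ∀ x, ∀ᶠ n in (hyperfilter ℕ : Filter ℕ), x ∈ ballVerts A (r n) := fun x =>
    Nat.hyperfilter_le_atTop ((eventually_ge_atTop (rho A x)).mono fun n hn => hn.trans (hr n))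
  have hlim : ∀ ξ : ∀ n, ball A (r n) ≃g ball A (r n), ∀ x, ∃ y,
      ∀ᶠ n in (hyperfilter ℕ : Filter ℕ), extendBall (ξ n) x = y := fun ξ x => by
    have h : ∀ᶠ n in (hyperfilter ℕ : Filter ℕ), ∃ y ∈ ballVerts A (rho A x),
        extendBall (ξ n) x = y :=
      (hlarge x).mono fun n hn => ⟨_, hA.rho_extendBall_le (ξ n) hn, rfl⟩
    rw [Ultrafilter.eventually_exists_mem_iff (hA.finite_ballVerts _)] at h
    obtain ⟨y, -, hy⟩ := h
    exact ⟨y, hy⟩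
  choose f hf using hlim φ
  choose g hg using hlim fun n => (φ n).symm
  let ψ : Gam A ≃g Gam A :=
    { toFun := f
      invFun := g
      left_inv := fun x => by
        obtain ⟨n, ⟨h1, h2⟩, h3⟩ := (((hf x).and (hg (f x))).and (hlarge x)).exists
        rw [← h2, ← h1, extendBall_symm_extendBall _ h3]
      right_inv := fun x => by
        obtain ⟨n, ⟨h1, h2⟩, h3⟩ := (((hg x).and (hf (g x))).and (hlarge x)).exists
        rw [← h2, ← h1, extendBall_extendBall_symm _ h3]
      map_rel_iff' := fun {x y} => by
        obtain ⟨n, ⟨h1, h2⟩, h3, h4⟩ :=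
          (((hf x).and (hf y)).and ((hlarge x).and (hlarge y))).exists
        change (Gam A).Adj (f x) (f y) ↔ (Gam A).Adj x y
        rw [hA.adj_iff, hA.adj_iff, ← h1, ← h2, hA.extendBall_sub_mem_iff _ h3 h4] }
  have h0 : ψ 0 = 0 := by
    obtain ⟨n, hn⟩ := (hf 0).exists
    change f 0 = 0
    rw [← hn, hA.extendBall_zero]
  obtain ⟨n, hn⟩ := ((eventually_all_finite (hA.finite_ballVerts s)).2 fun x _ => hf x).exists
  obtain ⟨x, hx, hne⟩ := hφ n ψ h0
  exact hne (hn x hx).symm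

theorem iso_eq_of_eqOn {ψ ψ' : Gam A ≃g Gam A} (h0 : ψ 0 = 0) (h0' : ψ' 0 = 0)
    (h : ∀ a ∈ A, ψ a = ψ' a) : ψ = ψ' := by
  ext1 x
  refine hA.induction (p := fun x => ψ x = ψ' x) (h0.trans h0'.symm) (fun v a ha hv => ?_) x
  rw [hA.map_add_of_map_zero ψ h0, hA.map_add_of_map_zero ψ' h0', hv, h a ha]

theorem mem_ballVerts_of_mem {a : Fin k → ℤ} (ha : a ∈ A) {r : ℕ} (hr : 1 ≤ r) :
    a ∈ ballVerts A r := by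
  change rho A a ≤ r
  rwa [hA.rho_eq_one ha]

theorem exists_isRigidRadius : ∃ R : ℕ, IsRigidRadius A R := by
  obtain ⟨R, hR⟩ := hA.exists_radius_forall_exists_iso A.card
  -- radius at least one puts `A` inside the ball, which makes the extension unique
  refine ⟨max R 1, fun r hr φ => ?_⟩
  obtain ⟨ψ, h0, hψ⟩ := hR r (le_trans (le_max_left _ _) hr) φ
  have hr1 : 1 ≤ r := le_trans (le_max_right _ _) hr
  have hext : ∀ x : ballVerts A r, ψ (x : Fin k → ℤ) = (φ x : Fin k → ℤ) := fun x => by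
    have := hA.eq_self_of_eq_self_on_ball (r := r) (f := fun x => ψ.symm (extendBall φ x))
      (fun x hx y hy => by
        rw [hA.map_sub_mem_iff ψ.symm, hA.extendBall_sub_mem_iff φ hx hy])
      (fun x hx => by rw [← hψ x hx, RelIso.symm_apply_apply]) x.2
    rw [← extendBall_of_mem, ← RelIso.apply_symm_apply ψ (extendBall φ x), this]
  refine ⟨?_, ψ, ⟨h0, hext⟩, ?_⟩
  · obtain ⟨T, hT⟩ := hA.exists_linearEquiv ψ h0
    exact ⟨T, fun x => by rw [← hext, hT]⟩
  · rintro ψ' ⟨h0', hψ'⟩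
    refine hA.iso_eq_of_eqOn h0' h0 fun a ha => ?_
    have hmem := hA.mem_ballVerts_of_mem ha hr1
    exact (hψ' ⟨a, hmem⟩).trans (hext ⟨a, hmem⟩).symm

/-- An injective adjacency-preserving map on the ball that fixes the origin is an automorphism of
the ball: it is a permutation of a finite set, and its inverse is one of its powers. -/
theorem exists_ball_iso {r : ℕ} {f : (Fin k → ℤ) → Fin k → ℤ}
    (hf : ∀ x ∈ ballVerts A r, ∀ y ∈ ballVerts A r, y - x ∈ A → f y - f x ∈ A)
    (hinj : Set.InjOn f (ballVerts A r)) (h0 : f 0 = 0) :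
    ∃ φ : ball A r ≃g ball A r, ∀ x : ballVerts A r, (φ x : Fin k → ℤ) = f x := by
  have hmaps : Set.MapsTo f (ballVerts A r) (ballVerts A r) := fun x hx => by
    have := hA.rho_map_sub_le hf hx
    rw [h0, sub_zero] at this
    exact this.trans hx
  have : Finite (ballVerts A r) := hA.finite_ballVerts r
  let σ : Equiv.Perm (ballVerts A r) :=
    Equiv.ofBijective (hmaps.restrict f _ _)
      (Finite.injective_iff_bijective.1 (hmaps.restrict_inj.2 hinj))
  have hpow : ∀ j : ℕ, ∀ x y, (ball A r).Adj x y → (ball A r).Adj ((σ ^ j) x) ((σ ^ j) y) := by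
    intro j
    induction j with
    | zero => exact fun x y h => h
    | succ j ih =>
      intro x y h
      rw [pow_succ]
      refine ih _ _ ?_
      exact hA.adj_iff.2 (hf x x.2 y y.2 (hA.adj_iff.1 h))
  refine ⟨⟨σ, fun {x y} => ⟨fun h => ?_, hpow 1 x y⟩⟩, fun x => rfl⟩
  have h1 := hpow (orderOf σ - 1) _ _ h
  have h2 : ∀ z, (σ ^ (orderOf σ - 1)) (σ z) = z := fun z => by
    rw [← Equiv.Perm.mul_apply, ← pow_succ, Nat.sub_add_cancel (orderOf_pos σ), pow_orderOf_eq_one,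
      Equiv.Perm.one_apply]
  rwa [h2, h2] at h1

/-! ### Ball bundles -/

/-- A map on a ball bundle acts on each of the balls, up to translation, as an automorphism of the
graph; since neighbouring balls share a vertex with all its neighbours, these automorphisms
coincide. -/
theorem exists_iso_of_bundle {R r : ℕ} (hR : IsRigidRadius A R) (hRr : R ≤ r) (hr : 2 ≤ r)
    {M : Set (Fin k → ℤ)} (hM : ((Gam A).induce M).Connected) {F : (Fin k → ℤ) → Fin k → ℤ}
    (hF : ∀ x ∈ bundleVerts A r M, ∀ y ∈ bundleVerts A r M, y - x ∈ A → F y - F x ∈ A)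
    (hinj : Set.InjOn F (bundleVerts A r M)) :
    ∃ (t : Fin k → ℤ) (ψ : Gam A ≃g Gam A), ψ 0 = 0 ∧ ∀ x ∈ bundleVerts A r M, F x = t + ψ x := by
  have hmem : ∀ c ∈ M, ∀ y ∈ ballVerts A r, c + y ∈ bundleVerts A r M := fun c hc y hy =>
    Set.mem_biUnion hc ⟨y, hy, add_comm y c⟩
  have hloc : ∀ c : M, ∃ ψ : Gam A ≃g Gam A, ψ 0 = 0 ∧
      ∀ y ∈ ballVerts A r, F (c + y) = F c + ψ y := fun c => by
    obtain ⟨φ, hφ⟩ := hA.exists_ball_iso (r := r) (f := fun y => F (c + y) - F c)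
      (fun x hx y hy hxy => by
        have := hF _ (hmem c c.2 x hx) _ (hmem c c.2 y hy) (by simpa using hxy)
        simpa using this)
      (fun x hx y hy hxy =>
        add_left_cancel (hinj (hmem c c.2 x hx) (hmem c c.2 y hy) (sub_left_injective hxy)))
      (by simp)
    obtain ⟨ψ, ⟨h0, hψ⟩, -⟩ := (hR r hRr φ).2
    exact ⟨ψ, h0, fun y hy => by rw [hψ ⟨y, hy⟩, hφ, add_sub_cancel]⟩
  choose ψ h0 hψ using hloc
  have hstep : ∀ c c' : M, ((Gam A).induce M).Adj c c' →
      ψ c' = ψ c ∧ F c' = F c + ψ c (c' - c) := fun c c' hcc => by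
    have ha : (c' : Fin k → ℤ) - c ∈ A := hA.adj_iff.1 hcc
    have hFc : F c' = F c + ψ c (c' - c) := by
      rw [← hψ c _ (hA.mem_ballVerts_of_mem ha (by omega)), add_sub_cancel]
    refine ⟨hA.iso_eq_of_eqOn (h0 c') (h0 c) fun b hb => ?_, hFc⟩
    have h1 := hψ c' b (hA.mem_ballVerts_of_mem hb (by omega))
    have h2 := hψ c (c' - c + b) (by
      have h3 := hA.rho_add_le_succ (x := (c' : Fin k → ℤ) - c) hb
      rw [hA.rho_eq_one ha] at h3
      exact h3.trans hr)
    rw [← add_assoc, add_sub_cancel, h1, hFc, hA.map_add_of_map_zero _ (h0 c), ← add_assoc] at h2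
    exact add_left_cancel h2
  obtain ⟨c₀⟩ := hM.nonempty
  have hall : ∀ c : M, ψ c = ψ c₀ ∧ F c = F c₀ + ψ c₀ (c - c₀) := fun c => by
    have hreach := (SimpleGraph.reachable_iff_reflTransGen _ _).1 (hM.preconnected c₀ c)
    induction hreach with
    | refl => exact ⟨rfl, by rw [sub_self, h0, add_zero]⟩
    | @tail b c _ hbc ih =>
      obtain ⟨h1, h2⟩ := hstep b c hbc
      refine ⟨h1.trans ih.1, ?_⟩
      rw [h2, ih.2, ih.1, add_assoc, ← hA.map_add_of_map_zero _ (h0 c₀), sub_add_sub_cancel']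
  refine ⟨F c₀ - ψ c₀ c₀, ψ c₀, h0 c₀, fun x hx => ?_⟩
  obtain ⟨c, hc, y, hy, rfl⟩ := Set.mem_iUnion₂.1 hx
  obtain ⟨h1, h2⟩ := hall ⟨c, hc⟩
  have h3 := hψ ⟨c, hc⟩ y hy
  have h4 := hA.map_add_of_map_zero _ (h0 c₀) (c - c₀) c₀
  rw [sub_add_cancel] at h4
  simp only at h2 h3 ⊢
  rw [add_comm y c, h3, h2, h1, hA.map_add_of_map_zero _ (h0 c₀) c y, h4]
  abel

/-- The composite of an automorphism and a translation. -/
def translateIso (t : Fin k → ℤ) (ψ : Gam A ≃g Gam A) : Gam A ≃g Gam A where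
  toEquiv := ψ.toEquiv.trans (Equiv.addLeft t)
  map_rel_iff' {x y} := by
    change (Gam A).Adj (t + ψ x) (t + ψ y) ↔ _
    rw [hA.adj_iff, hA.adj_iff, add_sub_add_left_eq_sub, hA.map_sub_mem_iff]

/-- Affine equivalences that agree on a translate of `A` and on its centre are equal. -/
theorem affineEquiv_ext {T T' : (Fin k → ℝ) ≃ᵃ[ℝ] (Fin k → ℝ)} (c : Fin k → ℤ)
    (hc : T (toReal c) = T' (toReal c))
    (h : ∀ a ∈ A, T (toReal (c + a)) = T' (toReal (c + a))) : T = T' := by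
  have hlin : (T.linear : (Fin k → ℝ) →ₗ[ℝ] (Fin k → ℝ)) = T'.linear :=
    hA.linearMap_ext fun a ha => by
      have := h a ha
      rw [toReal_add, add_comm, ← vadd_eq_add, AffineEquiv.map_vadd, AffineEquiv.map_vadd,
        hc] at this
      exact vadd_right_cancel _ this
  ext1 x
  have hx : x = (x - toReal c) +ᵥ toReal c := by simp
  rw [hx, AffineEquiv.map_vadd, AffineEquiv.map_vadd, hc]
  congr 1
  exact LinearMap.congr_fun hlin _

end IsConnectionSet
end BallBundle

theorem mainTheorem3 (k : ℕ) (A : Finset (Fin k → ℤ))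
    (hzero : (0 : Fin k → ℤ) ∉ A)
    (hsymm : ∀ x ∈ A, -x ∈ A)
    (hgen : AddSubgroup.closure (A : Set (Fin k → ℤ)) = ⊤) :
    (∃ D : ℕ, BallBundle.DetectsSecondary A D) ∧
    (∃ R : ℕ, BallBundle.IsRigidRadius A R) ∧
    ∀ D R : ℕ, BallBundle.DetectsSecondary A D → BallBundle.IsRigidRadius A R →
      ∀ r : ℕ, R ≤ r → 2 ≤ r → D ≤ r → 2 * BallBundle.normA A + 1 ≤ r →
      ∀ M : Set (Fin k → ℤ), ((BallBundle.Gam A).induce M).Connected →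
      ∀ (lam : (BallBundle.Gam A).Subgraph) (φ : BallBundle.bundle A r M ≃g lam.coe),
        ∃ T : (Fin k → ℝ) ≃ᵃ[ℝ] (Fin k → ℝ),
          (∀ x : BallBundle.bundleVerts A r M,
            BallBundle.toReal (φ x : Fin k → ℤ) = T (BallBundle.toReal (x : Fin k → ℤ))) ∧
          (∀ T' : (Fin k → ℝ) ≃ᵃ[ℝ] (Fin k → ℝ),
            (∀ x : BallBundle.bundleVerts A r M,
              BallBundle.toReal (φ x : Fin k → ℤ) = T' (BallBundle.toReal (x : Fin k → ℤ))) →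
            T' = T) ∧
          ∃ ψ : BallBundle.Gam A ≃g BallBundle.Gam A,
            ∀ x : Fin k → ℤ, BallBundle.toReal (ψ x) = T (BallBundle.toReal x) := by
  classical
  have hA : BallBundle.IsConnectionSet A := ⟨hzero, hsymm, hgen⟩
  refine ⟨hA.exists_detectsSecondary, hA.exists_isRigidRadius, ?_⟩
  intro D R _ hR r hRr hr _ _ M hM lam φ
  let F : (Fin k → ℤ) → Fin k → ℤ := fun x =>
    if h : x ∈ BallBundle.bundleVerts A r M then φ ⟨x, h⟩ else 0
  have hF : ∀ x : BallBundle.bundleVerts A r M, F x = φ x := fun x => dif_pos x.2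
  obtain ⟨t, ψ, h0, hψ⟩ := hA.exists_iso_of_bundle (F := F) hR hRr hr hM
    (fun x hx y hy hxy => by
      rw [hF ⟨x, hx⟩, hF ⟨y, hy⟩, ← hA.adj_iff]
      refine lam.adj_sub (φ.map_adj_iff.2 (?_ : (BallBundle.bundle A r M).Adj ⟨x, hx⟩ ⟨y, hy⟩))
      exact hA.adj_iff.2 hxy)
    (fun x hx y hy hxy => by
      rw [hF ⟨x, hx⟩, hF ⟨y, hy⟩] at hxy
      exact congrArg Subtype.val (φ.injective (Subtype.ext hxy)))
  obtain ⟨S, hS⟩ := hA.exists_linearEquiv ψ h0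
  let T : (Fin k → ℝ) ≃ᵃ[ℝ] (Fin k → ℝ) :=
    S.toAffineEquiv.trans (AffineEquiv.constVAdd ℝ (Fin k → ℝ) (BallBundle.toReal t))
  have hT : ∀ x, BallBundle.toReal (t + ψ x) = T (BallBundle.toReal x) := fun x => by
    rw [BallBundle.toReal_add, hS]
    rfl
  have hφT : ∀ x : BallBundle.bundleVerts A r M,
      BallBundle.toReal (φ x : Fin k → ℤ) = T (BallBundle.toReal (x : Fin k → ℤ)) := fun x => by
    rw [← hF, hψ x x.2, hT]
  refine ⟨T, hφT, fun T' hT' => ?_, hA.translateIso t ψ, hT⟩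
  obtain ⟨c, hc⟩ := hM.nonempty
  have hmem : ∀ y ∈ BallBundle.ballVerts A r, c + y ∈ BallBundle.bundleVerts A r M :=
    fun y hy => Set.mem_biUnion hc ⟨y, hy, add_comm y c⟩
  have h00 : (0 : Fin k → ℤ) ∈ BallBundle.ballVerts A r :=
    (BallBundle.IsConnectionSet.rho_zero (A := A)).le.trans (Nat.zero_le r)
  refine hA.affineEquiv_ext c ?_ fun a ha => ?_
  · have hcm := hmem 0 h00
    rw [add_zero] at hcm
    rw [← hT' ⟨c, hcm⟩, ← hφT ⟨c, hcm⟩]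
  · have hcm := hmem a (hA.mem_ballVerts_of_mem ha (by omega))
    rw [← hT' ⟨c + a, hcm⟩, ← hφT ⟨c + a, hcm⟩]
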